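/- Write points of the plane $\mathbb R^2$ as $(t,x)$, and for $U\subseteq\mathbb R^2$ put $U_t:=\{x\in\mathbb R\mid (t,x)\in U\}$. A set $U\subseteq\mathbb R^2$ is called $x$-simple if for every $t\in\mathbb R$ the set $U_t$ is an open (possibly unbounded) interval or empty. An $x$-simple piece of $U$ is a connected component of $U\cap(I\times\mathbb R)$, for some open interval $I\subseteq\mathbb R$, that is an $x$-simple set. Let $\Omega\subseteq\mathbb R^2$ be a nonempty open set. For $p\in\mathbb N=\{1,2,\dots\}$ and a continuous matrix function $A\in \mathrm C(\Omega,\mathrm M_p(\mathbb R))$, a solution on $\Omega$ of the system $v_x=Av$ is a continuous function $v\colon\Omega\to\mathbb R^p$ whose partial derivative $v_x$ exists and is continuous on $\Omega$ and which satisfies $v_x(t,x)=A(t,x)v(t,x)$ for all $(t,x)\in\Omega$. Then $\Omega$ contains no $x$-simple pieces if and only if for each $p\in\mathbb N$ there exists an infinite-parameter family of systems $v_x=Av$ with $A\in\mathrm C(\Omega,\mathrm M_p(\mathbb R))$ each of which possesses only the zero solution on $\Omega$. Here an infinite-parameter family means a family $(A_c)_{c\in\mathbb R^{\mathbb N}}$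 such that the map $c\mapsto A_c$ from $\mathbb R^{\mathbb N}$ (with the product topology) to $\mathrm C(\Omega,\mathrm M_p(\mathbb R))$ (with the topology of locally uniform convergence) is continuous and injective. -/

import Mathlib

/-- The section `U_t = {x | (t, x) ∈ U}` of a subset of the `(t, x)`-plane. -/
def xSection (U : Set (ℝ × ℝ)) (t : ℝ) : Set ℝ := {x | (t, x) ∈ U}

/-- A subset of the `(t, x)`-plane is `x`-simple if each of its sections by a line `t = const`
is an open (bounded or unbounded) interval or empty. -/
def IsXSimple (U : Set (ℝ × ℝ)) : Prop :=
  ∀ t : ℝ, IsOpen (xSection U t) ∧ (xSection U t).OrdConnected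

/-- `V` is an `x`-simple piece of `U`: for some open interval `I` of the `t`-axis, `V` is a
connected component of `U ∩ (I × ℝ)`, and `V` is `x`-simple. Components are nonempty, being the
components of points. -/
def IsXSimplePiece (U V : Set (ℝ × ℝ)) : Prop :=
  ∃ I : Set ℝ, IsOpen I ∧ I.OrdConnected ∧
    (∃ z ∈ U ∩ I ×ˢ Set.univ, V = connectedComponentIn (U ∩ I ×ˢ Set.univ) z) ∧ IsXSimple V

/-- The partial derivative with respect to `x` of a vector function of `(t, x)`. -/
noncomputable def xDeriv {p : ℕ} (v : ℝ × ℝ → Fin p → ℝ) (z : ℝ × ℝ) : Fin p → ℝ :=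
  deriv (fun x : ℝ => v (z.1, x)) z.2

/-- The class `C¹_x(Ω, ℝᵖ)`: continuous on `Ω`, with a derivative in `x` that exists and is
(jointly) continuous on `Ω`. Values outside the open set `Ω` are irrelevant. -/
def MemC1x {p : ℕ} (Ω : Set (ℝ × ℝ)) (v : ℝ × ℝ → Fin p → ℝ) : Prop :=
  ContinuousOn v Ω ∧
    (∀ z ∈ Ω, DifferentiableAt ℝ (fun x : ℝ => v (z.1, x)) z.2) ∧
    ContinuousOn (xDeriv v) Ω

/-- `v` is a classical solution on `Ω` of the system `v_x = A v`. -/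
def IsSystemSolution {p : ℕ} (Ω : Set (ℝ × ℝ)) (A : C(Ω, Matrix (Fin p) (Fin p) ℝ))
    (v : ℝ × ℝ → Fin p → ℝ) : Prop :=
  MemC1x Ω v ∧ ∀ z : Ω, xDeriv v z = (A z).mulVec (v z)

/-- The system `v_x = A v` possesses only the zero solution on `Ω`. -/
def HasOnlyZeroSolution {p : ℕ} (Ω : Set (ℝ × ℝ)) (A : C(Ω, Matrix (Fin p) (Fin p) ℝ)) : Prop :=
  ∀ v : ℝ × ℝ → Fin p → ℝ, IsSystemSolution Ω A v → ∀ z ∈ Ω, v z = 0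

/-- A family of elements of a topological space that depends continuously on infinitely many
independent real parameters `c 0, c 1, c 2, …`, all of which are essential: different parameter
sequences give different elements. -/
def IsInfiniteParameterFamily {X : Type*} [TopologicalSpace X] (F : (ℕ → ℝ) → X) : Prop :=
  Continuous F ∧ Function.Injective F

open Set Filter Topology

/-! On a vertical segment inside `Ω`, a solution of `u_x = g u` satisfies `u(t, y) = exp(∫ g) u(t,
r)`. Suppose there are no `x`-simple pieces. Then every horizontal segment in `Ω` contains a point
`(t, r)` with a gap (`exists_isGap`). If the integrals of `a` across the gap are unbounded as `t' →
t`, continuity of `u` at `(t, y)` forces `u(t, r) = 0`. Baire category gives one `a` that works for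
countably many gaps (`exists_integral_unbounded`), enough to make the zeros of `u` dense. Adding a
continuous `f(t)` to `a` does no harm, which supplies the parameters; multiples of the identity
matrix decouple into scalar equations. Conversely, over an `x`-simple piece the exponential formula
with a cutoff in `t` gives a nonzero scalar solution, so `p = 1` already fails. -/

/-- Tietze extension from a closed thickening of the segment; it lets integrals with moving endpoint
and parameter be treated as those of a globally continuous function. -/
theorem exists_continuous_eq_near_segment {Ω : Set (ℝ × ℝ)} (hΩ : IsOpen Ω) {g : ℝ × ℝ → ℝ}
    (hg : ContinuousOn g Ω) {t x y : ℝ} (h : ∀ s ∈ uIcc x y, (t, s) ∈ Ω) :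
    ∃ G : ℝ × ℝ → ℝ, Continuous G ∧ ∃ δ > 0, ∀ t' y' : ℝ, |t' - t| < δ → |y' - y| < δ →
      ∀ s ∈ uIcc x y', (t', s) ∈ Ω ∧ G (t', s) = g (t', s) := by
  have hK : IsCompact ({t} ×ˢ uIcc x y : Set (ℝ × ℝ)) := isCompact_singleton.prod isCompact_uIcc
  obtain ⟨δ, hδ, hsub⟩ := hK.exists_cthickening_subset_open hΩ (by
    rintro ⟨a, b⟩ ⟨rfl, hb⟩
    exact h b hb)
  set C := Metric.cthickening δ ({t} ×ˢ uIcc x y : Set (ℝ × ℝ))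
  obtain ⟨G, hG⟩ := ContinuousMap.exists_restrict_eq (s := C) Metric.isClosed_cthickening
    ⟨C.domRestrict g, (hg.mono hsub).domRestrict⟩
  refine ⟨G, G.continuous, δ, hδ, fun t' y' ht hy s hs => ?_⟩
  have hmem : (t', s) ∈ C := by
    obtain ⟨s', hs', hss⟩ : ∃ s' ∈ uIcc x y, |s - s'| ≤ δ := by
      by_cases hsm : s ∈ uIcc x y
      · exact ⟨s, hsm, by simpa using hδ.le⟩
      · refine ⟨y, right_mem_uIcc, ?_⟩
        rw [abs_lt] at hy
        rw [abs_le]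
        rw [mem_uIcc] at hs hsm
        grind
    refine Metric.mem_cthickening_of_dist_le (t', s) (t, s') δ _ ⟨rfl, hs'⟩ ?_
    rw [Prod.dist_eq]
    exact max_le ht.le hss
  exact ⟨hsub hmem, congrArg (fun F => F ⟨_, hmem⟩) hG⟩

theorem eq_exp_integral_mul_of_hasDerivAt {B u : ℝ → ℝ} (hB : Continuous B) {x y : ℝ}
    (hu : ∀ s ∈ uIcc x y, HasDerivAt u (B s * u s) s) :
    u y = Real.exp (∫ s in x..y, B s) * u x := by
  have hw : ∀ s ∈ uIcc x y, HasDerivWithinAt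
      (fun s => Real.exp (-∫ r in x..s, B r) * u s) 0 (uIcc x y) s := by
    intro s hs
    have h := (((hB.integral_hasStrictDerivAt x s).hasDerivAt.neg.exp).mul (hu s hs))
    refine (h.congr_deriv ?_).hasDerivWithinAt
    simp only [Pi.neg_apply]
    ring
  have := (convex_uIcc x y).norm_image_sub_le_of_norm_hasDerivWithin_le (C := 0) hw
    (by simp) left_mem_uIcc right_mem_uIcc
  simp only [zero_mul, norm_le_zero_iff, sub_eq_zero, intervalIntegral.integral_same, neg_zero,
    Real.exp_zero, one_mul] at this
  rw [← this, ← mul_assoc, ← Real.exp_add]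
  simp

/-! ### Gaps and `x`-simple pieces -/

/-- The points `(t, r)` and `(t, y)` of `Ω` are separated by a hole of `Ω` on the line through them,
but the segments from `(t', r)` to `(t', y)` lie in `Ω` for `t'` arbitrarily close to `t`. -/
structure IsGap (Ω : Set (ℝ × ℝ)) (t r y : ℝ) : Prop where
  left_mem : (t, r) ∈ Ω
  right_mem : (t, y) ∈ Ω
  hole : ∃ m ∈ uIcc r y, (t, m) ∉ Ω
  joined : ∃ᶠ t' in 𝓝 t, ∀ s ∈ uIcc r y, (t', s) ∈ Ω

/-- Without gaps, the points of the strip joined to the line `x = r` by vertical segments in `Ω`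
form a connected, relatively clopen set, hence a component; its sections are intervals. -/
theorem exists_isGap {Ω : Set (ℝ × ℝ)} (hΩ : IsOpen Ω)
    (hno : ¬ ∃ V : Set (ℝ × ℝ), IsXSimplePiece Ω V) {a b r : ℝ} (hab : a < b)
    (hr : ∀ t ∈ Ioo a b, (t, r) ∈ Ω) : ∃ t ∈ Ioo a b, ∃ y, IsGap Ω t r y := by
  by_contra! hgap
  set W := Ω ∩ Ioo a b ×ˢ (univ : Set ℝ) with hW
  set S : Set (ℝ × ℝ) := {z | z.1 ∈ Ioo a b ∧ ∀ s ∈ uIcc r z.2, (z.1, s) ∈ Ω} with hS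
  have hWo : IsOpen W := hΩ.inter (isOpen_Ioo.prod isOpen_univ)
  have hSW : S ⊆ W := fun z hz => ⟨hz.2 _ right_mem_uIcc, hz.1, trivial⟩
  have hSo : IsOpen S := by
    rw [Metric.isOpen_iff]
    rintro ⟨t, y⟩ ⟨ht, hy⟩
    obtain ⟨_, _, δ, hδ, h⟩ := exists_continuous_eq_near_segment hΩ
      (continuousOn_const (c := (0 : ℝ))) hy
    obtain ⟨ε, hε, hball⟩ := Metric.isOpen_iff.1 isOpen_Ioo t ht
    refine ⟨min δ ε, lt_min hδ hε, ?_⟩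
    rintro ⟨t', y'⟩ hz
    rw [Metric.mem_ball, Prod.dist_eq, max_lt_iff, lt_min_iff, lt_min_iff] at hz
    exact ⟨hball hz.1.2, fun s hs => (h t' y' hz.1.1 hz.2.1 s hs).1⟩
  have hcl : closure S ∩ W ⊆ S := by
    rintro ⟨t, y⟩ ⟨hc, hzΩ, ht, -⟩
    by_contra hn
    refine hgap t ht y ⟨hr t ht, hzΩ, ?_, ?_⟩
    · by_contra! hm
      exact hn ⟨ht, hm⟩
    -- The degenerate segment at `y` yields a box in `Ω` covering the part between `y'` and `y`.
    · obtain ⟨_, _, δ, hδ, h⟩ := exists_continuous_eq_near_segment hΩ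
        (continuousOn_const (c := (0 : ℝ))) (t := t) (x := y) (y := y) (by simpa using hzΩ)
      rw [Metric.nhds_basis_ball.frequently_iff]
      intro ε hε
      obtain ⟨⟨t', y'⟩, hz', hd⟩ := Metric.mem_closure_iff.1 hc (min δ ε) (lt_min hδ hε)
      rw [dist_comm, Prod.dist_eq, max_lt_iff, lt_min_iff, lt_min_iff] at hd
      refine ⟨t', hd.1.2, fun s hs => ?_⟩
      by_cases hs' : s ∈ uIcc r y'
      · exact hz'.2 s hs'
      · refine (h t' y' hd.1.1 hd.2.1 s ?_).1
        rw [mem_uIcc] at *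
        grind
  obtain ⟨t₀, ht₀⟩ := exists_between hab
  have h₀S : ∀ t ∈ Ioo a b, (t, r) ∈ S := fun t ht => ⟨ht, by simpa using hr t ht⟩
  have hVS : connectedComponentIn W (t₀, r) = S := by
    refine Subset.antisymm ?_ ?_
    · refine isPreconnected_connectedComponentIn.subset_of_closure_inter_subset hSo
        ⟨_, mem_connectedComponentIn (hSW (h₀S t₀ ht₀)), h₀S t₀ ht₀⟩ ?_
      exact (inter_subset_inter_right _ (connectedComponentIn_subset _ _)).trans hcl
    · refine IsPreconnected.subset_connectedComponentIn ?_ (h₀S t₀ ht₀) hSW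
      have hpc : IsPreconnected (Ioo a b ×ˢ {r} : Set (ℝ × ℝ)) :=
        isPreconnected_Ioo.prod isPreconnected_singleton
      refine isPreconnected_of_forall (t₀, r) fun z hz => ?_
      refine ⟨Ioo a b ×ˢ {r} ∪ {z.1} ×ˢ uIcc r z.2, ?_, ?_, ?_, ?_⟩
      · rintro ⟨t, y⟩ (⟨ht, rfl⟩ | ⟨rfl, hy⟩)
        · exact h₀S t ht
        · exact ⟨hz.1, fun s hs => hz.2 s (uIcc_subset_uIcc_left hy hs)⟩
      · exact Or.inl ⟨ht₀, rfl⟩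
      · exact Or.inr ⟨rfl, right_mem_uIcc⟩
      · exact hpc.union (z.1, r) ⟨hz.1, rfl⟩ ⟨rfl, left_mem_uIcc⟩
          (isPreconnected_singleton.prod isPreconnected_uIcc)
  refine hno ⟨S, Ioo a b, isOpen_Ioo, ordConnected_Ioo,
    ⟨(t₀, r), hSW (h₀S t₀ ht₀), hVS.symm⟩, fun t => ⟨?_, ⟨?_⟩⟩⟩
  · exact hSo.preimage (Continuous.prodMk_right t)
  · rintro y ⟨ht, hy⟩ y' ⟨-, hy'⟩ w hw
    refine ⟨ht, fun s hs => ?_⟩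
    by_cases h : s ∈ uIcc r y
    · exact hy s h
    · refine hy' s ?_
      simp only [mem_uIcc, mem_Icc] at *
      grind

/-! ### Coefficients with unbounded integrals -/

/-- Extension by zero of a continuous function on `Ω` to the plane. -/
noncomputable def extZero {Ω : Set (ℝ × ℝ)} (a : C(Ω, ℝ)) : ℝ × ℝ → ℝ :=
  Function.extend Subtype.val a 0

theorem extZero_apply {Ω : Set (ℝ × ℝ)} (a : C(Ω, ℝ)) (z : Ω) : extZero a z = a z :=
  Subtype.val_injective.extend_apply _ _ _

theorem continuousOn_extZero {Ω : Set (ℝ × ℝ)} (a : C(Ω, ℝ)) : ContinuousOn (extZero a) Ω := by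
  rw [continuousOn_iff_continuous_domRestrict]
  convert a.continuous using 1
  ext z
  exact extZero_apply a z

theorem continuous_integral_extZero {Ω : Set (ℝ × ℝ)} (hΩ : IsOpen Ω) {t x y : ℝ}
    (h : ∀ s ∈ uIcc x y, (t, s) ∈ Ω) :
    Continuous fun a : C(Ω, ℝ) => ∫ s in x..y, extZero a (t, s) := by
  have : LocallyCompactSpace Ω := hΩ.locallyCompactSpace
  -- Clamping `s` keeps the point in `Ω` for every real `s`.
  let e : ℝ → Ω := fun s =>
    ⟨(t, projIcc (min x y) (max x y) min_le_max s), h _ (Subtype.coe_prop _)⟩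
  have he : Continuous e := by
    refine Continuous.subtype_mk ?_ _
    exact continuous_const.prodMk (continuous_subtype_val.comp continuous_projIcc)
  have hc : Continuous (Function.uncurry fun (a : C(Ω, ℝ)) (s : ℝ) => a (e s)) := by
    unfold Function.uncurry
    exact continuous_fst.eval (he.comp continuous_snd)
  convert intervalIntegral.continuous_parametric_intervalIntegral_of_continuous'
    (μ := MeasureTheory.volume) hc x y using 2 with a
  refine intervalIntegral.integral_congr fun s hs => ?_
  have : (t, s) = (e s : ℝ × ℝ) := by
    simp only [e]
    rw [projIcc_of_mem min_le_max hs]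
  simp only [this, extZero_apply]

theorem integral_ne_zero_of_nonneg {f : ℝ → ℝ} (hf : Continuous f) (h₀ : ∀ s, 0 ≤ f s)
    {x y m : ℝ} (hxy : x ≠ y) (hm : m ∈ uIcc x y) (hpos : 0 < f m) :
    ∫ s in x..y, f s ≠ 0 := by
  rcases hxy.lt_or_gt with h | h
  · rw [uIcc_of_lt h] at hm
    exact (intervalIntegral.integral_pos h hf.continuousOn (fun s _ => h₀ s) ⟨m, hm, hpos⟩).ne'
  · rw [uIcc_of_gt h] at hm
    rw [intervalIntegral.integral_symm, neg_ne_zero]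
    exact (intervalIntegral.integral_pos h hf.continuousOn (fun s _ => h₀ s) ⟨m, hm, hpos⟩).ne'

/-- Bumps shrinking to the hole `(t, m)` eventually vanish near each point of `Ω`, so however tall
they are, adding them perturbs `a` little locally uniformly. -/
theorem IsGap.dense_integral {Ω : Set (ℝ × ℝ)} (hΩ : IsOpen Ω) {t r y : ℝ} (hg : IsGap Ω t r y)
    {ε : ℝ} (hε : 0 < ε) (N : ℝ) :
    Dense {a : C(Ω, ℝ) | ∃ t', |t' - t| < ε ∧ (∀ s ∈ uIcc r y, (t', s) ∈ Ω) ∧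
      N < ∫ s in r..y, extZero a (t', s)} := by
  have : LocallyCompactSpace Ω := hΩ.locallyCompactSpace
  intro a
  obtain ⟨m, hm, hmΩ⟩ := hg.hole
  have hry : r ≠ y := by
    rintro rfl
    rw [uIcc_self] at hm
    exact hmΩ (mem_singleton_iff.1 hm ▸ hg.left_mem)
  let ρ : ℕ → ℝ := fun j => 1 / ((j : ℝ) + 1)
  have hρ : ∀ j, 0 < ρ j := fun j => by positivity
  have hρ0 : Tendsto ρ atTop (𝓝 0) := tendsto_one_div_add_atTop_nhds_zero_nat
  have hj := fun j => Metric.nhds_basis_ball.frequently_iff.1 hg.joined _ (lt_min hε (hρ j))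
  choose τ hτ hτΩ using hj
  let ψ : ℕ → ℝ × ℝ → ℝ := fun j z => max 0 (ρ j - dist z (t, m))
  have hψ : ∀ j, Continuous (ψ j) := fun j => by fun_prop
  have hψs : ∀ j, Continuous fun s => ψ j (τ j, s) := fun j => by fun_prop
  have hI : ∀ j, ∫ s in r..y, ψ j (τ j, s) ≠ 0 := fun j => by
    refine integral_ne_zero_of_nonneg (hψs j) (fun s => le_max_left _ _) hry hm ?_
    have := (lt_min_iff.1 (Metric.mem_ball.1 (hτ j))).2
    simpa [ψ, Prod.dist_eq, hρ j] using this
  -- This height makes the new integral exactly `N + 1`.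
  let M : ℕ → ℝ := fun j =>
    (N + 1 - ∫ s in r..y, extZero a (τ j, s)) / ∫ s in r..y, ψ j (τ j, s)
  let b : ℕ → C(Ω, ℝ) := fun j => ⟨fun z => a z + M j * ψ j z, by fun_prop⟩
  refine mem_closure_of_tendsto (f := b) (b := atTop) ?_ (Eventually.of_forall fun j => ?_)
  · rw [ContinuousMap.tendsto_iff_tendstoLocallyUniformly, Metric.tendstoLocallyUniformly_iff]
    intro η hη z
    have hz : 0 < dist (z : ℝ × ℝ) (t, m) := dist_pos.2 fun h => hmΩ (h ▸ z.2)
    refine ⟨{w | dist (z : ℝ × ℝ) (t, m) / 2 < dist (w : ℝ × ℝ) (t, m)}, ?_, ?_⟩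
    · exact (isOpen_lt continuous_const (by fun_prop)).mem_nhds (half_lt_self hz)
    · filter_upwards [hρ0.eventually_lt_const (half_pos hz)] with j hj w hw
      have hw' : dist (z : ℝ × ℝ) (t, m) / 2 < dist (w : ℝ × ℝ) (t, m) := hw
      have : ψ j w = 0 := max_eq_left (by linarith)
      simpa [b, this] using hη
  · refine ⟨τ j, (lt_min_iff.1 (Metric.mem_ball.1 (hτ j))).1, hτΩ j, ?_⟩
    have h1 : ∫ s in r..y, extZero (b j) (τ j, s) =
        ∫ s in r..y, (extZero a (τ j, s) + M j * ψ j (τ j, s)) := by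
      refine intervalIntegral.integral_congr fun s hs => ?_
      have h := hτΩ j s hs
      exact (extZero_apply (b j) ⟨_, h⟩).trans
        (congrArg (· + M j * ψ j (τ j, s)) (extZero_apply a ⟨_, h⟩).symm)
    have hia : IntervalIntegrable (fun s => extZero a (τ j, s)) MeasureTheory.volume r y := by
      refine ContinuousOn.intervalIntegrable ?_
      exact (continuousOn_extZero a).comp (by fun_prop) (fun s hs => hτΩ j s hs)
    rw [h1, intervalIntegral.integral_add hia (((hψs j).const_mul _).intervalIntegrable _ _),
      intervalIntegral.integral_const_mul, div_mul_cancel₀ _ (hI j)]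
    linarith

theorem exists_integral_unbounded {Ω : Set (ℝ × ℝ)} (hΩ : IsOpen Ω) {ι : Type*} [Countable ι]
    {t r y : ι → ℝ} (hg : ∀ i, IsGap Ω (t i) (r i) (y i)) :
    ∃ a : C(Ω, ℝ), ∀ i, ∀ n : ℕ, ∃ t', |t' - t i| < 1 / ((n : ℝ) + 1) ∧
      (∀ s ∈ uIcc (r i) (y i), (t', s) ∈ Ω) ∧ n < ∫ s in r i..y i, extZero a (t', s) := by
  have : LocallyCompactSpace Ω := hΩ.locallyCompactSpace
  have hd := dense_iInter_of_isOpen (X := C(Ω, ℝ)) (ι := ι × ℕ)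
    (f := fun k => {a : C(Ω, ℝ) | ∃ t', |t' - t k.1| < 1 / ((k.2 : ℝ) + 1) ∧
      (∀ s ∈ uIcc (r k.1) (y k.1), (t', s) ∈ Ω) ∧
        k.2 < ∫ s in r k.1..y k.1, extZero a (t', s)})
    (fun k => by
      simp only [ofPred_exists]
      refine isOpen_iUnion fun t' => ?_
      by_cases h : ∀ s ∈ uIcc (r k.1) (y k.1), (t', s) ∈ Ω
      · exact isOpen_const.and (isOpen_const.and
          (isOpen_lt continuous_const (continuous_integral_extZero hΩ h)))
      · simp [h])
    (fun k => (hg k.1).dense_integral hΩ (by positivity) _)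
  obtain ⟨a, ha⟩ := hd.nonempty
  exact ⟨a, fun i n => mem_iInter.1 ha (i, n)⟩

/-! ### The parameter family -/

/-- A real function of `t` depending injectively on a sequence of parameters; the parameter `c n`
only affects the values at `t > τ n`. -/
noncomputable def hatSeries (τ : ℕ → ℝ) (c : ℕ → ℝ) (t : ℝ) : ℝ :=
  ∑' n, Real.arctan (c n) * ((1 / 2) ^ n * min 1 (max 0 (t - τ n)))

theorem norm_hatSeries_term_le (τ c : ℕ → ℝ) (t : ℝ) (n : ℕ) :
    ‖Real.arctan (c n) * ((1 / 2) ^ n * min 1 (max 0 (t - τ n)))‖ ≤ 2 * (1 / 2) ^ n := by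
  have h0 : 0 ≤ min 1 (max 0 (t - τ n)) := le_min zero_le_one (le_max_left _ _)
  have h1 : ‖Real.arctan (c n)‖ ≤ 2 := by
    rw [Real.norm_eq_abs, abs_le]
    have := Real.pi_le_four
    exact ⟨by linarith [Real.neg_pi_div_two_lt_arctan (c n)],
      by linarith [Real.arctan_lt_pi_div_two (c n)]⟩
  rw [norm_mul]
  refine mul_le_mul h1 ?_ (norm_nonneg _) zero_le_two
  rw [Real.norm_of_nonneg (by positivity)]
  exact mul_le_of_le_one_right (by positivity) (min_le_left _ _)

theorem summable_two_mul_geometric : Summable fun n : ℕ => (2 : ℝ) * (1 / 2) ^ n :=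
  summable_geometric_two.mul_left 2

theorem continuous_hatSeries (τ : ℕ → ℝ) :
    Continuous fun q : (ℕ → ℝ) × ℝ => hatSeries τ q.1 q.2 := by
  refine continuous_tsum (fun n => ?_) summable_two_mul_geometric
    (fun n q => norm_hatSeries_term_le τ q.1 q.2 n)
  have h1 : Continuous fun q : (ℕ → ℝ) × ℝ => q.1 n := (continuous_apply n).comp continuous_fst
  have h2 := Real.continuous_arctan.comp h1
  exact h2.mul (by fun_prop)

/-- At `τ (n + 1)` the terms beyond `n` vanish and those before `n` agree by induction, which
isolates `c n`. -/
theorem eq_of_hatSeries_eq {τ : ℕ → ℝ} (hτ : StrictMono τ) {c d : ℕ → ℝ}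
    (h : ∀ n, hatSeries τ c (τ n) = hatSeries τ d (τ n)) : c = d := by
  funext n
  induction n using Nat.strong_induction_on with
  | _ n ih =>
    have hs : ∀ c : ℕ → ℝ, Summable fun k =>
        Real.arctan (c k) * ((1 / 2) ^ k * min 1 (max 0 (τ (n + 1) - τ k))) := fun c =>
      summable_two_mul_geometric.of_norm_bounded (norm_hatSeries_term_le τ c _)
    have h1 := sub_eq_zero.2 (h (n + 1))
    unfold hatSeries at h1
    rw [← (hs c).tsum_sub (hs d), tsum_eq_single n] at h1
    · rw [← sub_mul, mul_eq_zero] at h1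
      have hpos : 0 < min 1 (max 0 (τ (n + 1) - τ n)) :=
        lt_min one_pos (lt_max_of_lt_right (sub_pos.2 (hτ n.lt_succ_self)))
      have h2 := h1.resolve_right (by positivity)
      exact Real.arctan_injective (sub_eq_zero.1 h2)
    · intro k hk
      rcases hk.lt_or_gt with hk | hk
      · rw [ih k hk, sub_self]
      · have : τ (n + 1) - τ k ≤ 0 := sub_nonpos.2 (hτ.monotone hk)
        simp [max_eq_left this]

/-- A solution of `u_x = (a + f(t)) u` vanishes at `(t, r)` if the integrals of `a` over the segments
from `(t', r)` to `(t', y)` are unbounded as `t'` approaches `t`. -/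
theorem eq_zero_of_integral_unbounded {Ω : Set (ℝ × ℝ)} (hΩ : IsOpen Ω) {a : C(Ω, ℝ)} {f : ℝ → ℝ}
    (hf : Continuous f) {u : ℝ × ℝ → ℝ} (hu : ContinuousOn u Ω)
    (hd : ∀ z : Ω, HasDerivAt (fun x => u (z.1.1, x)) ((a z + f z.1.1) * u z) z.1.2)
    {t r y : ℝ} (hr : (t, r) ∈ Ω) (hy : (t, y) ∈ Ω)
    (ha : ∀ n : ℕ, ∃ t', |t' - t| < 1 / ((n : ℝ) + 1) ∧
      (∀ s ∈ uIcc r y, (t', s) ∈ Ω) ∧ n < ∫ s in r..y, extZero a (t', s)) :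
    u (t, r) = 0 := by
  choose τ hτ hτΩ hI using ha
  have hτt : Tendsto τ atTop (𝓝 t) := by
    rw [tendsto_iff_dist_tendsto_zero]
    exact squeeze_zero (fun _ => dist_nonneg) (fun n => (hτ n).le)
      tendsto_one_div_add_atTop_nhds_zero_nat
  have hI' : Tendsto (fun n => ∫ s in r..y, extZero a (τ n, s)) atTop atTop :=
    tendsto_atTop_mono (fun n => (hI n).le) tendsto_natCast_atTop_atTop
  have hJ : Tendsto (fun n => (∫ s in r..y, extZero a (τ n, s)) + (y - r) * f (τ n)) atTop atTop :=
    hI'.atTop_add (((hf.tendsto t).comp hτt).const_mul (y - r))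
  have hsol : ∀ n, u (τ n, y) =
      Real.exp ((∫ s in r..y, extZero a (τ n, s)) + (y - r) * f (τ n)) * u (τ n, r) := by
    intro n
    obtain ⟨G, hG, δ, hδ, hGe⟩ := exists_continuous_eq_near_segment hΩ (continuousOn_extZero a)
      (hτΩ n)
    have hGe' : ∀ s ∈ uIcc r y, G (τ n, s) = extZero a (τ n, s) := fun s hs =>
      (hGe (τ n) y (by simpa using hδ) (by simpa using hδ) s hs).2
    have hGc : Continuous fun s => G (τ n, s) := by fun_prop
    rw [eq_exp_integral_mul_of_hasDerivAt (B := fun s => G (τ n, s) + f (τ n))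
      (u := fun s => u (τ n, s)) (x := r) (y := y) (by fun_prop) (fun s hs => ?_),
      intervalIntegral.integral_add (hGc.intervalIntegrable _ _) (by simp),
      intervalIntegral.integral_const, smul_eq_mul, intervalIntegral.integral_congr hGe']
    rw [hGe' s hs, extZero_apply a ⟨_, hτΩ n s hs⟩]
    exact hd ⟨_, hτΩ n s hs⟩
  have hlim : ∀ x, (t, x) ∈ Ω → Tendsto (fun n => u (τ n, x)) atTop (𝓝 (u (t, x))) := fun x hx =>
    ((hu.continuousAt (hΩ.mem_nhds hx)).tendsto).comp (hτt.prodMk_nhds tendsto_const_nhds)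
  -- Solve for `u (τ n, r)`: a factor tending to `0` times a convergent one.
  have h0 : Tendsto (fun n => u (τ n, r)) atTop (𝓝 (0 * u (t, y))) := by
    refine ((Real.tendsto_exp_neg_atTop_nhds_zero.comp hJ).mul (hlim y hy)).congr fun n => ?_
    rw [hsol n, ← mul_assoc, Function.comp_apply, ← Real.exp_add]
    simp
  rw [zero_mul] at h0
  exact tendsto_nhds_unique (hlim r hr) h0

theorem exists_family_of_no_xSimplePiece {Ω : Set (ℝ × ℝ)} (hΩ : IsOpen Ω) (hne : Ω.Nonempty)
    (hno : ¬ ∃ V : Set (ℝ × ℝ), IsXSimplePiece Ω V) {p : ℕ} (hp : 1 ≤ p) :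
    ∃ A : (ℕ → ℝ) → C(Ω, Matrix (Fin p) (Fin p) ℝ),
      IsInfiniteParameterFamily A ∧ ∀ c : ℕ → ℝ, HasOnlyZeroSolution Ω (A c) := by
  -- Rational horizontal segments: countable, yet one lies in every nonempty open subset of `Ω`.
  let ι := {q : ℚ × ℚ × ℚ // (q.1 : ℝ) < q.2.1 ∧ ∀ t ∈ Ioo (q.1 : ℝ) q.2.1, (t, (q.2.2 : ℝ)) ∈ Ω}
  choose t ht y hgap using fun i : ι => exists_isGap hΩ hno i.2.1 i.2.2
  obtain ⟨a, ha⟩ := exists_integral_unbounded hΩ hgap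
  obtain ⟨⟨t₀, x₀⟩, hz₀⟩ := hne
  obtain ⟨δ, hδ, hball⟩ := Metric.isOpen_iff.1 hΩ _ hz₀
  let τ : ℕ → ℝ := fun n => t₀ - δ / ((n : ℝ) + 2)
  have hτ : StrictMono τ := fun m n hmn => by
    have : (m : ℝ) < n := Nat.cast_lt.2 hmn
    simp only [τ]
    gcongr
  have hτΩ : ∀ n, (τ n, x₀) ∈ Ω := fun n => hball (by
    have : δ / ((n : ℝ) + 2) < δ := div_lt_self hδ (by linarith [n.cast_nonneg (α := ℝ)])
    have h0 : 0 < δ / ((n : ℝ) + 2) := by positivity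
    rw [Metric.mem_ball, Prod.dist_eq, max_lt_iff, Real.dist_eq, dist_self, abs_lt]
    exact ⟨⟨by simp only [τ]; linarith, by simp only [τ]; linarith⟩, hδ⟩)
  have hcont : Continuous fun q : (ℕ → ℝ) × Ω => a q.2 + hatSeries τ q.1 q.2.1.1 := by
    refine (a.continuous.comp continuous_snd).add ((continuous_hatSeries τ).comp
      (g := fun q : (ℕ → ℝ) × ℝ => hatSeries τ q.1 q.2)
      (f := fun q : (ℕ → ℝ) × Ω => (q.1, q.2.1.1)) ?_)
    fun_prop
  have hcont' : Continuous fun q : (ℕ → ℝ) × Ω =>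
      (a q.2 + hatSeries τ q.1 q.2.1.1) • (1 : Matrix (Fin p) (Fin p) ℝ) :=
    hcont.smul continuous_const
  let A : (ℕ → ℝ) → C(Ω, Matrix (Fin p) (Fin p) ℝ) := fun c =>
    ⟨fun z => (a z + hatSeries τ c z.1.1) • 1, hcont'.comp (Continuous.prodMk_right c)⟩
  refine ⟨A, ⟨ContinuousMap.continuous_of_continuous_uncurry A hcont', fun c d hcd => ?_⟩, ?_⟩
  · refine eq_of_hatSeries_eq hτ fun n => ?_
    have h := congrFun (congrFun (DFunLike.congr_fun hcd ⟨_, hτΩ n⟩) ⟨0, hp⟩) ⟨0, hp⟩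
    simpa [A] using h
  · rintro c v ⟨⟨hv, hvd, -⟩, hsol⟩ z hz
    funext i
    have hu : ContinuousOn (fun z => v z i) Ω := (continuous_apply i).comp_continuousOn hv
    have hd : ∀ z : Ω, HasDerivAt (fun x => v (z.1.1, x) i)
        ((a z + hatSeries τ c z.1.1) * v z i) z.1.2 := by
      intro z
      have h := hasDerivAt_pi.1 (hvd z z.2).hasDerivAt i
      refine h.congr_deriv ?_
      have := congrFun (hsol z) i
      simp only [A, ContinuousMap.coe_mk, Matrix.smul_mulVec, Matrix.one_mulVec, Pi.smul_apply,
        smul_eq_mul] at this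
      exact this
    have hf : Continuous (hatSeries τ c) := (continuous_hatSeries τ).comp (Continuous.prodMk_right c)
    have hzero : ∀ j : ι, v (t j, (j.1.2.2 : ℝ)) i = 0 := fun j =>
      eq_zero_of_integral_unbounded hΩ hf hu hd (hgap j).left_mem (hgap j).right_mem (ha j)
    by_contra hvz
    have hW : IsOpen (Ω ∩ (fun z => v z i) ⁻¹' {0}ᶜ) :=
      hu.isOpen_inter_preimage hΩ isOpen_compl_singleton
    obtain ⟨ε, hε, hεW⟩ := Metric.isOpen_iff.1 hW z ⟨hz, hvz⟩
    obtain ⟨q₁, h₁, h₁'⟩ := exists_rat_btwn (show z.1 - ε < z.1 by linarith)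
    obtain ⟨q₂, h₂, h₂'⟩ := exists_rat_btwn (show z.1 < z.1 + ε by linarith)
    obtain ⟨q₃, h₃, h₃'⟩ := exists_rat_btwn (show z.2 < z.2 + ε by linarith)
    have hbox : ∀ s ∈ Ioo (q₁ : ℝ) q₂, (s, (q₃ : ℝ)) ∈ Ω ∩ (fun z => v z i) ⁻¹' {0}ᶜ := by
      intro s hs
      refine hεW ?_
      rw [Metric.mem_ball, Prod.dist_eq, max_lt_iff, Real.dist_eq, Real.dist_eq, abs_lt, abs_lt]
      obtain ⟨hs1, hs2⟩ := hs
      exact ⟨⟨by dsimp only; linarith, by dsimp only; linarith⟩,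
        by dsimp only; linarith, by dsimp only; linarith⟩
    let j : ι := ⟨(q₁, q₂, q₃), h₁'.trans h₂, fun s hs => (hbox s hs).1⟩
    exact (hbox (t j) (ht j)).2 (hzero j)

/-! ### Nonzero solutions over an `x`-simple piece -/

/-- Over an `x`-simple piece `V` of `Ω` every scalar equation has a solution that is nonzero
somewhere in `V` and vanishes on the rest of `Ω`. -/
theorem exists_scalar_solution_of_xSimplePiece {Ω V : Set (ℝ × ℝ)} (hΩ : IsOpen Ω)
    (hV : IsXSimplePiece Ω V) {g : ℝ × ℝ → ℝ} (hg : ContinuousOn g Ω) :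
    ∃ u : ℝ × ℝ → ℝ, ContinuousOn u Ω ∧
      (∀ z ∈ Ω, HasDerivAt (fun x => u (z.1, x)) (g z * u z) z.2) ∧ ∃ z ∈ Ω, u z ≠ 0 := by
  classical
  obtain ⟨I, hIo, -, ⟨⟨t₀, x₀⟩, hz₀, rfl⟩, hsimple⟩ := hV
  set W := Ω ∩ I ×ˢ (univ : Set ℝ)
  set V := connectedComponentIn W (t₀, x₀) with hVdef
  have hWo : IsOpen W := hΩ.inter (hIo.prod isOpen_univ)
  have hVo : IsOpen V := hWo.connectedComponentIn
  have hVW : V ⊆ W := connectedComponentIn_subset _ _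
  have hz₀V : (t₀, x₀) ∈ V := mem_connectedComponentIn hz₀
  obtain ⟨ε, hε, hball⟩ := Metric.isOpen_iff.1 hVo _ hz₀V
  have hline : ∀ t, |t - t₀| < ε → (t, x₀) ∈ V := fun t ht =>
    hball (by simpa [Prod.dist_eq, hε, Real.dist_eq] using ht)
  -- The support stays strictly within the range `|t - t₀| < ε` where `(t, x₀)` is in `V`.
  let φ : ℝ → ℝ := fun t => max 0 (ε / 2 - |t - t₀|)
  have hφ : Continuous φ := by fun_prop
  let u : ℝ × ℝ → ℝ := fun z =>
    if z ∈ V then φ z.1 * Real.exp (∫ s in x₀..z.2, g (z.1, s)) else 0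
  have hloc : ∀ z ∈ Ω, ContinuousAt u z ∧ HasDerivAt (fun x => u (z.1, x)) (g z * u z) z.2 := by
    rintro ⟨t, x⟩ hz
    have hzero : (∀ᶠ w in 𝓝 (t, x), u w = 0) → ContinuousAt u (t, x) ∧
        HasDerivAt (fun x => u (t, x)) (g (t, x) * u (t, x)) x := by
      intro h
      refine ⟨continuousAt_const.congr (h.mono fun _ => Eq.symm), ?_⟩
      rw [h.self_of_nhds, mul_zero]
      exact (hasDerivAt_const x (0 : ℝ)).congr_of_eventuallyEq
        ((Continuous.prodMk_right t).continuousAt.eventually h)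
    by_cases ht : |t - t₀| < ε
    · by_cases hzV : (t, x) ∈ V
      · have hseg : ∀ t' x', |t' - t₀| < ε → (t', x') ∈ V → ∀ s ∈ uIcc x₀ x', (t', s) ∈ V :=
          fun t' x' ht' hx' s hs => (hsimple t').2.uIcc_subset (hline t' ht') hx' hs
        obtain ⟨G, hG, δ, hδ, hGe⟩ := exists_continuous_eq_near_segment hΩ hg
          (fun s hs => (hVW (hseg t x ht hzV s hs)).1)
        let F : ℝ × ℝ → ℝ := fun z => φ z.1 * Real.exp (∫ s in x₀..z.2, G (z.1, s))
        have huF : ∀ᶠ w in 𝓝 (t, x), u w = F w := by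
          filter_upwards [hVo.mem_nhds hzV, Metric.ball_mem_nhds (t, x) hδ] with w hwV hwδ
          rw [Metric.mem_ball, Prod.dist_eq, max_lt_iff] at hwδ
          simp only [u, F, if_pos hwV]
          rw [intervalIntegral.integral_congr fun s hs =>
            (hGe w.1 w.2 hwδ.1 hwδ.2 s hs).2]
        have hGz : G (t, x) = g (t, x) :=
          (hGe t x (by simpa using hδ) (by simpa using hδ) x right_mem_uIcc).2
        have hFc : Continuous F := by
          refine (hφ.comp continuous_fst).mul (Real.continuous_exp.comp ?_)
          exact intervalIntegral.continuous_parametric_intervalIntegral_of_continuous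
            (f := fun (z : ℝ × ℝ) s => G (z.1, s)) (by unfold Function.uncurry; fun_prop)
            continuous_snd
        refine ⟨hFc.continuousAt.congr (huF.mono fun _ => Eq.symm), ?_⟩
        have hGt : Continuous fun s => G (t, s) := by fun_prop
        have hFd := ((hGt.integral_hasStrictDerivAt x₀ x).hasDerivAt.exp).const_mul (φ t)
        rw [huF.self_of_nhds, ← hGz]
        refine (hFd.congr_deriv ?_).congr_of_eventuallyEq
          ((Continuous.prodMk_right t).continuousAt.eventually huF)
        simp only [F]
        ring
      -- The component of `(t, x)` in `W` is open and disjoint from `V`.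
      · refine hzero ?_
        have hzW : (t, x) ∈ W := ⟨hz, (hVW (hline t ht)).2.1, trivial⟩
        filter_upwards [hWo.connectedComponentIn.mem_nhds (mem_connectedComponentIn hzW)]
          with w hw
        refine if_neg fun hwV => hzV ?_
        have := (connectedComponentIn_eq hw).trans (connectedComponentIn_eq hwV).symm
        exact hVdef ▸ this ▸ mem_connectedComponentIn hzW
    · refine hzero ?_
      have ho : IsOpen {w : ℝ × ℝ | ε / 2 < |w.1 - t₀|} := isOpen_lt continuous_const (by fun_prop)
      filter_upwards [ho.mem_nhds (show ε / 2 < |t - t₀| by linarith)] with w hw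
      have : φ w.1 = 0 := max_eq_left (by linarith [show ε / 2 < |w.1 - t₀| from hw])
      simp [u, this]
  refine ⟨u, fun z hz => (hloc z hz).1.continuousWithinAt, fun z hz => (hloc z hz).2,
    (t₀, x₀), hz₀.1, ?_⟩
  simp [u, hz₀V, φ, hε]

theorem exists_nonzero_solution_of_xSimplePiece {Ω V : Set (ℝ × ℝ)} (hΩ : IsOpen Ω)
    (hV : IsXSimplePiece Ω V) (A : C(Ω, Matrix (Fin 1) (Fin 1) ℝ)) :
    ¬ HasOnlyZeroSolution Ω A := by
  intro hA
  let a : C(Ω, ℝ) := ⟨fun z => A z 0 0, by fun_prop⟩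
  obtain ⟨u, hu, hd, z, hz, huz⟩ := exists_scalar_solution_of_xSimplePiece hΩ hV
    (continuousOn_extZero a)
  have hder : ∀ z ∈ Ω, HasDerivAt (fun x => (fun _ : Fin 1 => u (z.1, x)))
      (fun _ => extZero a z * u z) z.2 := fun z hz => hasDerivAt_pi.2 fun _ => hd z hz
  refine huz (congrFun (hA (fun z _ => u z) ⟨⟨?_, ?_, ?_⟩, ?_⟩ z hz) 0)
  · exact continuousOn_pi.2 fun _ => hu
  · exact fun z hz => (hder z hz).differentiableAt
  · exact (continuousOn_pi.2 fun _ => (continuousOn_extZero a).mul hu).congr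
      fun z hz => (hder z hz).deriv
  · intro z
    refine (hder z z.2).deriv.trans ?_
    funext i
    rw [extZero_apply, Subsingleton.elim i 0]
    simp [a, Matrix.mulVec, dotProduct]

theorem mainTheorem9 (Ω : Set (ℝ × ℝ)) (hΩ : IsOpen Ω) (hne : Ω.Nonempty) :
    (¬ ∃ V : Set (ℝ × ℝ), IsXSimplePiece Ω V) ↔
      ∀ p : ℕ, 1 ≤ p →
        ∃ A : (ℕ → ℝ) → C(Ω, Matrix (Fin p) (Fin p) ℝ),
          IsInfiniteParameterFamily A ∧ ∀ c : ℕ → ℝ, HasOnlyZeroSolution Ω (A c) := by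
  refine ⟨fun hno p hp => exists_family_of_no_xSimplePiece hΩ hne hno hp, ?_⟩
  rintro h ⟨V, hV⟩
  obtain ⟨A, -, hA⟩ := h 1 le_rfl
  exact exists_nonzero_solution_of_xSimplePiece hΩ hV (A 0) (hA 0)
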